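/- Let $n\ge 1$ be an integer and let $D$ be a set of positive divisors of $n$, all different from $n$. The integral circulant graph $\mathrm{ICG}_n(D)$ has vertex set $\mathbb{Z}/n\mathbb{Z}$, and two distinct vertices $a,b$ are adjacent if and only if $b-a\in S$, where $S=\{k\in\mathbb{Z}/n\mathbb{Z} : k\neq 0,\ \gcd(k,n)\in D\}$. Let $A$ be its adjacency matrix and $F(t)=\exp(\mathrm{i}tA)$. The graph has perfect state transfer (PST) if there are distinct vertices $a,b$ and a real number $t>0$ with $|F(t)_{ab}|=1$. The eigenvalues of $\mathrm{ICG}_n(D)$ are indexed as $\lambda_j=\sum_{s\in S}\omega_n^{js}$, $0\le j\le n-1$, where $\omega_n=e^{2\pi \mathrm{i}/n}$. Then $\mathrm{ICG}_n(D)$ has PST if and only if one of the following two conditions holds: (i) $n/2\notin D$, and for all $0\le j\le n-1$: $\lambda_j$ is an integer with $\lambda_j\equiv 2\pmod 4$ if $j$ is even, and $\lambda_j=0$ if $j$ is odd; (ii) $n/2\in D$, and for all $0\le j\le n-1$: $\lambda_j$ is an integer with $\lambda_j\equiv 1\pmod 4$ if $j$ is even, and $\lambda_j=-1$ if $j$ is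 odd. (If $n$ is odd, $n/2$ is not an integer and so $n/2\notin D$.) -/

import Mathlib

/-- The transition matrix `F(t) = exp(i A_G t)` of the quantum walk on a finite graph `G`, where
`A_G` is the adjacency matrix of `G` over `ℂ`. -/
noncomputable def SimpleGraph.transition {V : Type*} [Fintype V] [DecidableEq V]
    (G : SimpleGraph V) [DecidableRel G.Adj] (t : ℝ) : Matrix V V ℂ :=
  NormedSpace.exp ((Complex.I * (t : ℂ)) • G.adjMatrix ℂ)

/-- `G` has perfect state transfer: `|F(t)_{ab}| = 1` for some distinct vertices `a`, `b` and some
time `t > 0`. -/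
def SimpleGraph.HasPST {V : Type*} [Fintype V] [DecidableEq V]
    (G : SimpleGraph V) [DecidableRel G.Adj] : Prop :=
  ∃ a b : V, a ≠ b ∧ ∃ t : ℝ, 0 < t ∧ ‖G.transition t a b‖ = 1

namespace ICG

/-- `G_n(d) = {k : gcd(k, n) = d, 1 ≤ k ≤ n - 1}`, as a set of residues modulo `n`. -/
def gcdClass (n : ℕ) [NeZero n] (d : ℕ) : Finset (ZMod n) :=
  {s | s ≠ 0 ∧ Nat.gcd s.val n = d}

/-- The symbol `S = ⋃_{d ∈ D} G_n(d)` of the integral circulant graph `ICG_n(D)`. -/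
def symbol (n : ℕ) [NeZero n] (D : Finset ℕ) : Finset (ZMod n) :=
  D.biUnion (gcdClass n)

/-- The integral circulant graph `ICG_n(D)`: the circulant graph on `ℤ/n` whose symbol is the set
of residues `k ≠ 0` with `gcd(k, n) ∈ D`. -/
def graph (n : ℕ) [NeZero n] (D : Finset ℕ) : SimpleGraph (ZMod n) :=
  SimpleGraph.circulantGraph (symbol n D : Set (ZMod n))

instance (n : ℕ) [NeZero n] (D : Finset ℕ) : DecidableRel (graph n D).Adj :=
  inferInstanceAs (DecidableRel
    (SimpleGraph.circulantGraph (symbol n D : Set (ZMod n))).Adj)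

/-- The primitive `n`-th root of unity `ω_n = exp(2πi/n)`. -/
noncomputable def omega (n : ℕ) : ℂ :=
  Complex.exp (2 * Real.pi * Complex.I / n)

/-- The `j`-th eigenvalue `λ_j = ∑_{s ∈ S} ω_n^{js}` of `ICG_n(D)`. -/
noncomputable def eigenvalue (n : ℕ) [NeZero n] (D : Finset ℕ) (j : ℕ) : ℂ :=
  ∑ s ∈ symbol n D, omega n ^ (j * s.val)

/-- The `j`-th eigenvector `v_j = (1, ω_n^j, ω_n^{2j}, …, ω_n^{(n-1)j})` of `ICG_n(D)`. -/
noncomputable def eigenvector (n : ℕ) [NeZero n] (j : ℕ) : ZMod n → ℂ :=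
  fun a => omega n ^ (j * a.val)

theorem mem_symbol {n : ℕ} [NeZero n] {D : Finset ℕ} {s : ZMod n} :
    s ∈ symbol n D ↔ s ≠ 0 ∧ Nat.gcd s.val n ∈ D := by
  simp [symbol, gcdClass]
  tauto

theorem neg_mem_symbol {n : ℕ} [NeZero n] {D : Finset ℕ} {s : ZMod n}
    (h : s ∈ symbol n D) : -s ∈ symbol n D := by
  rw [mem_symbol] at h ⊢
  obtain ⟨h0, h1⟩ := h
  refine ⟨neg_ne_zero.mpr h0, ?_⟩
  have : NeZero s := ⟨h0⟩
  rw [ZMod.val_neg_of_ne_zero, Nat.gcd_comm, Nat.gcd_self_sub_right (ZMod.val_lt s).le,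
    Nat.gcd_comm]
  exact h1

theorem graph_adj {n : ℕ} [NeZero n] {D : Finset ℕ} {a b : ZMod n} :
    (graph n D).Adj a b ↔ b - a ∈ symbol n D := by
  simp only [graph, SimpleGraph.circulantGraph_adj, Finset.mem_coe]
  constructor
  · rintro ⟨_, h | h⟩
    · simpa using neg_mem_symbol h
    · exact h
  · intro h
    refine ⟨?_, Or.inr h⟩
    rintro rfl
    exact (mem_symbol.mp h).1 (sub_self a)

theorem omega_pow_self (n : ℕ) [NeZero n] : omega n ^ n = 1 :=
  (Complex.isPrimitiveRoot_exp n (NeZero.ne n)).pow_eq_one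

/-- The numbers `eigenvalue n D j` are eigenvalues of the adjacency matrix of `ICG_n(D)`. -/
theorem adjMatrix_mulVec_eigenvector (n : ℕ) [NeZero n] (D : Finset ℕ) (j : ℕ) :
    ((graph n D).adjMatrix ℂ).mulVec (eigenvector n j) =
      eigenvalue n D j • eigenvector n j := by
  ext a
  simp only [Matrix.mulVec, dotProduct, SimpleGraph.adjMatrix_apply, graph_adj, ite_mul, one_mul,
    zero_mul, Pi.smul_apply, smul_eq_mul, eigenvalue, eigenvector]
  rw [← Equiv.sum_comp (Equiv.addRight a)]
  simp only [Equiv.coe_addRight, add_sub_cancel_right]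
  rw [← Finset.sum_filter, Finset.filter_mem_eq_inter, Finset.univ_inter, Finset.sum_mul]
  refine Finset.sum_congr rfl fun s _ => ?_
  rw [ZMod.val_add, mul_comm j, pow_mul, ← pow_eq_pow_mod _ (omega_pow_self n), ← pow_mul,
    ← pow_add]
  congr 1
  ring

end ICG

open Finset in
theorem geom_sum_eq_zero_of_pow_eq_one {z : ℂ} {m : ℕ} (hz : z ^ m = 1) (h1 : z ≠ 1) :
    ∑ i ∈ range m, z ^ i = 0 := by
  have h := geom_sum_mul z m
  rw [hz, sub_self] at h
  exact (mul_eq_zero.mp h).resolve_right (sub_ne_zero.mpr h1)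

open Finset in
theorem IsPrimitiveRoot.sum_pow_mul_inv_pow {θ : ℂ} {m x y : ℕ} (hθ : IsPrimitiveRoot θ m)
    (hx : x < m) (hy : y < m) :
    ∑ i ∈ range m, θ ^ (i * y) * θ⁻¹ ^ (i * x) = if y = x then (m : ℂ) else 0 := by
  have h0 : θ ≠ 0 := hθ.ne_zero (by omega)
  have hrw : ∀ i, θ ^ (i * y) * θ⁻¹ ^ (i * x) = (θ ^ y * θ⁻¹ ^ x) ^ i := fun i => by
    rw [mul_pow, ← pow_mul, ← pow_mul, mul_comm i, mul_comm i]
  simp only [hrw]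
  split_ifs with hxy
  · subst hxy
    simp [h0]
  · refine geom_sum_eq_zero_of_pow_eq_one ?_ fun h => hxy ?_
    · rw [mul_pow, ← pow_mul, ← pow_mul, mul_comm y, mul_comm x, pow_mul, pow_mul, inv_pow,
        hθ.pow_eq_one]
      simp
    · rw [inv_pow, mul_inv_eq_one₀ (pow_ne_zero _ h0)] at h
      exact hθ.pow_inj hy hx h

theorem Int.dvd_of_mul_eq_of_isIntegral {q b : ℤ} (hq : q ≠ 0) {S : ℂ} (hS : IsIntegral ℤ S)
    (h : (q : ℂ) * S = b) : q ∣ b := by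
  have hqC : (q : ℂ) ≠ 0 := by exact_mod_cast hq
  have hS' : S = algebraMap ℚ ℂ ((b : ℚ) / q) := by
    rw [eq_comm, map_div₀]
    simp only [map_intCast]
    rw [← h]
    field_simp
  rw [hS', isIntegral_algebraMap_iff (algebraMap ℚ ℂ).injective,
    IsIntegrallyClosed.isIntegral_iff] at hS
  obtain ⟨z, hz⟩ := hS
  refine ⟨z, ?_⟩
  have hqQ : (q : ℚ) ≠ 0 := by exact_mod_cast hq
  rw [eq_div_iff hqQ] at hz
  have : z * q = b := by
    rw [eq_intCast] at hz
    exact_mod_cast hz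
  rw [← this, mul_comm]

open Finset in
/-- An integer function on `ℤ/m` whose Fourier transform consists of integers that are all
congruent to `c` modulo `q`, with `q` coprime to `m`, is congruent to `c` times the indicator of
`0` modulo `q`. -/
theorem IsPrimitiveRoot.dvd_of_sum_modEq {θ : ℂ} {m : ℕ} (hθ : IsPrimitiveRoot θ m) {q c : ℤ}
    (hq0 : q ≠ 0) (hq : IsCoprime q (m : ℤ)) {h : ℕ → ℤ}
    (H : ∀ i : ℕ, ∃ l : ℤ, l ≡ c [ZMOD q] ∧ ∑ y ∈ range m, (h y : ℂ) * θ ^ (i * y) = l)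
    {x : ℕ} (hx : x < m) : q ∣ h x - if x = 0 then c else 0 := by
  choose l hl hsum using H
  have hk : ∀ i, ∃ k : ℤ, l i = c + q * k := fun i => by
    obtain ⟨k, hk⟩ := (hl i).symm.dvd
    exact ⟨k, by rw [← hk]; ring⟩
  choose k hk using hk
  have hθi : IsIntegral ℤ θ⁻¹ := hθ.inv.isIntegral (by omega)
  have h1 : ∑ i ∈ range m, (l i : ℂ) * θ⁻¹ ^ (i * x) = m * h x := by
    simp only [← hsum, sum_mul]
    rw [sum_comm]
    simp only [mul_assoc, ← mul_sum]
    rw [sum_congr rfl fun y hy => by rw [hθ.sum_pow_mul_inv_pow hx (mem_range.mp hy)]]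
    simp [hx, mul_comm]
  have h2 : ∑ i ∈ range m, (c : ℂ) * θ⁻¹ ^ (i * x) = m * (if x = 0 then c else 0 : ℤ) := by
    have := hθ.sum_pow_mul_inv_pow hx (show 0 < m by omega)
    simp only [mul_zero, pow_zero, one_mul] at this
    rw [← mul_sum, this]
    rcases eq_or_ne x 0 with rfl | h0
    · simp [mul_comm]
    · simp [h0, h0.symm]
  refine hq.dvd_of_dvd_mul_left (Int.dvd_of_mul_eq_of_isIntegral hq0
    (S := ∑ i ∈ range m, (k i : ℂ) * θ⁻¹ ^ (i * x)) ?_ ?_)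
  · exact IsIntegral.sum _ fun i _ => (isIntegral_algebraMap (R := ℤ) (x := k i)).mul (hθi.pow _)
  · push_cast at h2 ⊢
    rw [mul_sub, ← h1, ← h2, ← sum_sub_distrib, mul_sum]
    refine sum_congr rfl fun i _ => ?_
    rw [hk]
    push_cast
    ring

open Finset in
theorem ZMod.sum_val_eq_sum_range {M : Type*} [AddCommMonoid M] (n : ℕ) [NeZero n] (F : ℕ → M) :
    ∑ s : ZMod n, F s.val = ∑ a ∈ range n, F a := by
  refine sum_bij' (fun s _ => s.val) (fun a _ => (a : ZMod n)) ?_ ?_ ?_ ?_ ?_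
  · exact fun s _ => mem_range.mpr (ZMod.val_lt s)
  · simp
  · simp
  · exact fun a ha => ZMod.val_cast_of_lt (mem_range.mp ha)
  · simp

open Finset in
/-- Chinese remaindering of sums: the numbers `u y + m r` represent each residue modulo `u m`
once. -/
theorem Nat.Coprime.sum_range_mul {M : Type*} [AddCommMonoid M] {u m : ℕ} (h : u.Coprime m)
    (hu : 0 < u) (hm : 0 < m) {F : ℕ → M} (hF : ∀ a, F (a % (u * m)) = F a) :
    ∑ a ∈ range (u * m), F a = ∑ y ∈ range m, ∑ r ∈ range u, F (u * y + m * r) := by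
  rw [← sum_product']
  symm
  have hmaps : ∀ p ∈ range m ×ˢ range u, (u * p.1 + m * p.2) % (u * m) ∈ range (u * m) :=
    fun p _ => mem_range.mpr (Nat.mod_lt _ (by positivity))
  have hinj : Set.InjOn (fun p : ℕ × ℕ => (u * p.1 + m * p.2) % (u * m))
      (range m ×ˢ range u : Finset (ℕ × ℕ)) := by
    rintro ⟨y, r⟩ h1 ⟨y', r'⟩ h2 heq
    simp only [coe_product, coe_range, Set.mem_prod, Set.mem_Iio] at h1 h2
    have heq' : u * y + m * r ≡ u * y' + m * r' [MOD u * m] := heq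
    have e1 : y ≡ y' [MOD m] := by
      have := heq'.of_mul_left u
      have : u * y ≡ u * y' [MOD m] := by
        simpa [Nat.ModEq, Nat.add_mul_mod_self_left] using this
      exact Nat.ModEq.cancel_left_of_coprime h.symm this
    have e2 : r ≡ r' [MOD u] := by
      have := heq'.of_mul_right m
      have : m * r ≡ m * r' [MOD u] := by
        simpa [Nat.ModEq, Nat.mul_add_mod] using this
      exact Nat.ModEq.cancel_left_of_coprime h this
    rw [e1.eq_of_lt_of_lt h1.1 h2.1, e2.eq_of_lt_of_lt h1.2 h2.2]
  refine sum_nbij (fun p : ℕ × ℕ => (u * p.1 + m * p.2) % (u * m)) hmaps hinj ?_ ?_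
  · refine surjOn_of_injOn_of_card_le _ hmaps hinj ?_
    simp [mul_comm]
  · exact fun p _ => (hF _).symm

/-- The greatest common divisor with a power of two only depends on the residue modulo a
smaller power of two that does not divide the number. -/
theorem Nat.gcd_two_pow_of_not_dvd {i k x : ℕ} (hik : i ≤ k) (hx : ¬ 2 ^ i ∣ x) :
    x.gcd (2 ^ k) = x.gcd (2 ^ i) := by
  refine Nat.dvd_antisymm (Nat.dvd_gcd (Nat.gcd_dvd_left _ _) ?_)
    (Nat.gcd_dvd_gcd_of_dvd_right _ (pow_dvd_pow 2 hik))
  obtain ⟨w, -, hw⟩ := (Nat.dvd_prime_pow Nat.prime_two).mp (Nat.gcd_dvd_right x (2 ^ k))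
  rw [hw]
  refine pow_dvd_pow 2 (le_of_not_ge fun h => hx ?_)
  exact (pow_dvd_pow 2 h).trans (hw ▸ Nat.gcd_dvd_left _ _)

theorem Nat.gcd_add_mul_two_pow {i k r : ℕ} (c : ℕ) (hik : i ≤ k) (h0 : 0 < r) (hr : r < 2 ^ i) :
    (r + c * 2 ^ i).gcd (2 ^ k) = r.gcd (2 ^ k) := by
  have h1 : ¬ 2 ^ i ∣ r := fun h => absurd (Nat.le_of_dvd h0 h) (by omega)
  rw [Nat.gcd_two_pow_of_not_dvd hik h1, Nat.gcd_two_pow_of_not_dvd hik, Nat.gcd_comm,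
    Nat.gcd_add_mul_right_right, Nat.gcd_comm]
  rwa [Nat.dvd_add_left (Dvd.intro_left _ rfl)]

open Finset in
/-- Odd frequencies of a function on `ℤ/2^(k+1)` that only depends on the gcd. -/
theorem sum_gcd_two_pow_mul_pow_of_half {k : ℕ} {z : ℂ} (hz : z ^ 2 ^ k = -1) (G : ℕ → ℂ) :
    ∑ r ∈ range (2 ^ (k + 1)), G (r.gcd (2 ^ (k + 1))) * z ^ r =
      G (2 ^ (k + 1)) - G (2 ^ k) := by
  have hsplit : 2 ^ (k + 1) = 2 ^ k + 2 ^ k := by ring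
  rw [show range (2 ^ (k + 1)) = range (2 ^ k + 2 ^ k) by rw [hsplit], sum_range_add,
    ← sum_add_distrib, sum_eq_single_of_mem 0 (by simp)]
  · have : (2 ^ k).gcd (2 ^ (k + 1)) = 2 ^ k := Nat.gcd_eq_left (pow_dvd_pow 2 k.le_succ)
    simp [hz, this]
    ring
  · intro r hr h0
    have := Nat.gcd_add_mul_two_pow (k := k + 1) 1 k.le_succ (by omega) (mem_range.mp hr)
    rw [one_mul, add_comm] at this
    rw [this, pow_add z, hz]
    ring

open Finset in
/-- Frequencies congruent to `2` modulo `4` of a function on `ℤ/2^(k+2)` that only depends on the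
gcd. -/
theorem sum_gcd_two_pow_mul_pow_of_quarter {k : ℕ} {z : ℂ} (hz : z ^ 2 ^ k = -1) (G : ℕ → ℂ) :
    ∑ r ∈ range (2 ^ (k + 2)), G (r.gcd (2 ^ (k + 2))) * z ^ r =
      G (2 ^ (k + 2)) + G (2 ^ (k + 1)) - 2 * G (2 ^ k) := by
  have hsplit : 2 ^ (k + 2) = 2 ^ k + 2 ^ k + 2 ^ k + 2 ^ k := by ring
  have hle : k ≤ k + 2 := by omega
  rw [show range (2 ^ (k + 2)) = range (2 ^ k + 2 ^ k + 2 ^ k + 2 ^ k) by rw [hsplit],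
    sum_range_add, sum_range_add, sum_range_add, ← sum_add_distrib, ← sum_add_distrib,
    ← sum_add_distrib, sum_eq_single_of_mem 0 (by simp)]
  · have h1 : (2 ^ k).gcd (2 ^ (k + 2)) = 2 ^ k := Nat.gcd_eq_left (pow_dvd_pow 2 hle)
    have h2 : (2 ^ k + 2 ^ k).gcd (2 ^ (k + 2)) = 2 ^ (k + 1) := by
      rw [show 2 ^ k + 2 ^ k = 2 ^ (k + 1) by ring]
      exact Nat.gcd_eq_left (pow_dvd_pow 2 (by omega))
    have h3 : (2 ^ k + 2 ^ k + 2 ^ k).gcd (2 ^ (k + 2)) = 2 ^ k := by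
      rw [show 2 ^ k + 2 ^ k + 2 ^ k = 2 ^ k * 3 by ring, pow_add, Nat.gcd_mul_left]
      norm_num
    simp only [add_zero, pow_zero, Nat.gcd_zero_left, h1, h2, h3, pow_add _ (2 ^ k), hz,
      pow_add _ (2 ^ k + 2 ^ k)]
    ring
  · intro r hr h0
    have h := fun c => Nat.gcd_add_mul_two_pow (k := k + 2) c hle (by omega) (mem_range.mp hr)
    have h1 : (2 ^ k + r).gcd (2 ^ (k + 2)) = r.gcd (2 ^ (k + 2)) := by
      rw [← h 1]; congr 1; ring
    have h2 : (2 ^ k + 2 ^ k + r).gcd (2 ^ (k + 2)) = r.gcd (2 ^ (k + 2)) := by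
      rw [← h 2]; congr 1; ring
    have h3 : (2 ^ k + 2 ^ k + 2 ^ k + r).gcd (2 ^ (k + 2)) = r.gcd (2 ^ (k + 2)) := by
      rw [← h 3]; congr 1; ring
    rw [h1, h2, h3]
    simp only [pow_add z, hz]
    ring

open Finset in
/-- Unit complex numbers whose average has norm one are all equal to that average. -/
theorem Complex.eq_average_of_norm_average_eq_one {n : ℕ} {z : ℕ → ℂ} (hz : ∀ i, ‖z i‖ = 1)
    (h : ‖(n : ℂ)⁻¹ * ∑ i ∈ range n, z i‖ = 1) {j : ℕ} (hj : j < n) :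
    z j = (n : ℂ)⁻¹ * ∑ i ∈ range n, z i := by
  set w := (n : ℂ)⁻¹ * ∑ i ∈ range n, z i with hw
  have hn : (n : ℂ) ≠ 0 := by exact_mod_cast (by omega : n ≠ 0)
  have hsum : ∑ i ∈ range n, ‖z i - w‖ ^ 2 = 0 := by
    have hexp : ∀ i, ‖z i - w‖ ^ 2 = 2 - 2 * (z i * (starRingEnd ℂ) w).re := fun i => by
      have h1 := hz i
      rw [← Complex.normSq_eq_norm_sq, Complex.normSq_sub, Complex.normSq_eq_norm_sq,
        Complex.normSq_eq_norm_sq, h1, h]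
      norm_num
    have hzw : ∑ i ∈ range n, z i = n * w := by
      rw [hw]; field_simp
    simp only [hexp]
    rw [sum_sub_distrib, ← mul_sum, ← Complex.re_sum, ← sum_mul, hzw, mul_assoc,
      Complex.mul_conj, Complex.normSq_eq_norm_sq, h]
    simp
    ring
  have := (sum_eq_zero_iff_of_nonneg fun i _ => by positivity).mp hsum j (mem_range.mpr hj)
  exact sub_eq_zero.mp (norm_eq_zero.mp (pow_eq_zero_iff two_ne_zero |>.mp this))

namespace ICG

theorem isPrimitiveRoot_omega (n : ℕ) [NeZero n] : IsPrimitiveRoot (omega n) n :=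
  Complex.isPrimitiveRoot_exp n (NeZero.ne n)

theorem omega_ne_zero (n : ℕ) : omega n ≠ 0 := Complex.exp_ne_zero _

theorem norm_omega (n : ℕ) [NeZero n] : ‖omega n‖ = 1 :=
  (isPrimitiveRoot_omega n).norm'_eq_one (NeZero.ne n)

theorem omega_pow_mul_mod (n : ℕ) [NeZero n] (j a : ℕ) :
    omega n ^ (j * (a % n)) = omega n ^ (j * a) := by
  rw [mul_comm j, pow_mul, ← pow_eq_pow_mod _ (omega_pow_self n), ← pow_mul, mul_comm a]

theorem omega_pow_mul_val_add (n : ℕ) [NeZero n] (j : ℕ) (a b : ZMod n) :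
    omega n ^ (j * (a + b).val) = omega n ^ (j * a.val) * omega n ^ (j * b.val) := by
  rw [ZMod.val_add, omega_pow_mul_mod, mul_add, pow_add]

/-- The discrete Fourier matrix, whose columns are the eigenvectors of `ICG_n(D)`. -/
noncomputable def fourier (n : ℕ) [NeZero n] : Matrix (ZMod n) (ZMod n) ℂ :=
  Matrix.of fun a j => eigenvector n j.val a

/-- The inverse of the discrete Fourier matrix. -/
noncomputable def fourierInv (n : ℕ) [NeZero n] : Matrix (ZMod n) (ZMod n) ℂ :=
  Matrix.of fun j b => (n : ℂ)⁻¹ * (omega n)⁻¹ ^ (j.val * b.val)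

theorem fourier_mul_fourierInv (n : ℕ) [NeZero n] : fourier n * fourierInv n = 1 := by
  ext a b
  have hn : (n : ℂ) ≠ 0 := NeZero.ne _
  simp only [Matrix.mul_apply, fourier, fourierInv, Matrix.of_apply, eigenvector, Matrix.one_apply,
    mul_left_comm _ (n : ℂ)⁻¹]
  rw [← Finset.mul_sum, ZMod.sum_val_eq_sum_range n fun j =>
    omega n ^ (j * a.val) * (omega n)⁻¹ ^ (j * b.val),
    (isPrimitiveRoot_omega n).sum_pow_mul_inv_pow (ZMod.val_lt b) (ZMod.val_lt a)]
  simp only [(ZMod.val_injective n).eq_iff, mul_ite, mul_zero, inv_mul_cancel₀ hn]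

theorem adjMatrix_mul_fourier (n : ℕ) [NeZero n] (D : Finset ℕ) :
    (graph n D).adjMatrix ℂ * fourier n =
      fourier n * Matrix.diagonal fun j : ZMod n => eigenvalue n D j.val := by
  ext a j
  rw [Matrix.mul_diagonal]
  have := congrFun (adjMatrix_mulVec_eigenvector n D j.val) a
  rw [Pi.smul_apply, smul_eq_mul, mul_comm] at this
  exact this

open Finset in
theorem transition_apply (n : ℕ) [NeZero n] (D : Finset ℕ) (t : ℝ) (a b : ZMod n) :
    (graph n D).transition t a b = (n : ℂ)⁻¹ * ∑ j ∈ range n,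
      Complex.exp (Complex.I * t * eigenvalue n D j) * omega n ^ (j * (a - b).val) := by
  have hPQ := fourier_mul_fourierInv n
  have hinv : (fourier n)⁻¹ = fourierInv n := Matrix.inv_eq_right_inv hPQ
  have hunit : IsUnit (fourier n) := IsUnit.of_mul_eq_one _ hPQ
  have hA : (Complex.I * (t : ℂ)) • (graph n D).adjMatrix ℂ = fourier n *
      Matrix.diagonal (fun j : ZMod n => Complex.I * t * eigenvalue n D j.val) *
      (fourier n)⁻¹ := by
    have h1 : (graph n D).adjMatrix ℂ = fourier n *
        Matrix.diagonal (fun j : ZMod n => eigenvalue n D j.val) * (fourier n)⁻¹ := by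
      rw [← adjMatrix_mul_fourier, mul_assoc, hinv, hPQ, mul_one]
    have h2 : Matrix.diagonal (fun j : ZMod n => Complex.I * t * eigenvalue n D j.val) =
        (Complex.I * (t : ℂ)) • Matrix.diagonal (fun j : ZMod n => eigenvalue n D j.val) := by
      rw [← Matrix.diagonal_smul]; rfl
    rw [h2, Matrix.mul_smul, Matrix.smul_mul, ← h1]
  rw [SimpleGraph.transition, hA, Matrix.exp_conj _ _ hunit, Matrix.exp_diagonal, hinv,
    Matrix.mul_apply]
  simp only [Matrix.mul_diagonal, fourier, fourierInv, Matrix.of_apply, eigenvector, Pi.coe_exp]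
  rw [← ZMod.sum_val_eq_sum_range n fun j =>
    Complex.exp (Complex.I * t * eigenvalue n D j) * omega n ^ (j * (a - b).val), mul_sum]
  refine sum_congr rfl fun j _ => ?_
  have : omega n ^ (j.val * a.val) * (omega n)⁻¹ ^ (j.val * b.val) =
      omega n ^ (j.val * (a - b).val) := by
    rw [inv_pow, mul_inv_eq_iff_eq_mul₀ (pow_ne_zero _ (omega_ne_zero n)),
      ← omega_pow_mul_val_add, sub_add_cancel]
  rw [← this, ← Complex.exp_eq_exp_ℂ]
  ring

theorem eigenvalue_mod (n : ℕ) [NeZero n] (D : Finset ℕ) (j : ℕ) :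
    eigenvalue n D (j % n) = eigenvalue n D j := by
  refine Finset.sum_congr rfl fun s _ => ?_
  rw [mul_comm, omega_pow_mul_mod, mul_comm]

theorem eigenvalue_sub (n : ℕ) [NeZero n] (D : Finset ℕ) {j : ℕ} (hj : j ≤ n) :
    eigenvalue n D (n - j) = eigenvalue n D j := by
  refine Finset.sum_nbij' (fun s => -s) (fun s => -s) (fun s => neg_mem_symbol)
    (fun s => neg_mem_symbol) (by simp) (by simp) fun s _ => ?_
  have h1 : omega n ^ (j * s.val) * omega n ^ (j * (-s).val) = 1 := by
    rw [← omega_pow_mul_val_add, add_neg_cancel]; simp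
  have h2 : omega n ^ (j * s.val) * omega n ^ ((n - j) * s.val) = 1 := by
    rw [← pow_add, ← add_mul, Nat.add_sub_cancel' hj, pow_mul, omega_pow_self, one_pow]
  exact mul_left_cancel₀ (pow_ne_zero _ (omega_ne_zero n)) (h2.trans h1.symm)

/-- Membership in the symbol, as an integer-valued function of the residue. -/
def indicator (n : ℕ) (D : Finset ℕ) (a : ℕ) : ℤ := if a.gcd n ∈ D then 1 else 0

theorem indicator_mod (n : ℕ) (D : Finset ℕ) (a : ℕ) :
    indicator n D (a % n) = indicator n D a := by
  rw [indicator, indicator, ← Nat.gcd_rec, Nat.gcd_comm]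

open Finset in
theorem eigenvalue_eq_sum_range {n : ℕ} [NeZero n] {D : Finset ℕ} (hD : n ∉ D) (j : ℕ) :
    eigenvalue n D j = ∑ a ∈ range n, (indicator n D a : ℂ) * omega n ^ (j * a) := by
  rw [← ZMod.sum_val_eq_sum_range n fun a => (indicator n D a : ℂ) * omega n ^ (j * a), eigenvalue,
    ← sum_filter_add_sum_filter_not univ (· ∈ symbol n D), filter_mem_eq_inter, univ_inter,
    sum_eq_zero (s := univ.filter (· ∉ symbol n D)), add_zero]
  · refine sum_congr rfl fun s hs => ?_
    simp [indicator, (mem_symbol.mp hs).2]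
  · intro s hs
    have hs' : s ∉ symbol n D := (mem_filter.mp hs).2
    have : s.val.gcd n ∉ D := by
      intro h
      rcases eq_or_ne s 0 with rfl | h0
      · simp [hD] at h
      · exact hs' (mem_symbol.mpr ⟨h0, h⟩)
    simp [indicator, this]

open Finset in
/-- The eigenvalues of an integral circulant graph are integers. -/
theorem exists_int_eigenvalue {n : ℕ} [NeZero n] {D : Finset ℕ} (hD : n ∉ D) (j : ℕ) :
    ∃ k : ℤ, eigenvalue n D j = k := by
  obtain ⟨c, hc⟩ : ∃ c : ℕ → ℤ, ∀ g > 0, ∑ d ∈ g.divisors, c d = if g ∈ D then 1 else 0 :=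
    ⟨_, ArithmeticFunction.sum_eq_iff_sum_mul_moebius_eq.mpr fun _ _ => rfl⟩
  have hn : 0 < n := NeZero.pos n
  have hind : ∀ a, indicator n D a = ∑ d ∈ n.divisors, if d ∣ a then c d else 0 := fun a => by
    rw [indicator, ← hc _ (Nat.gcd_pos_of_pos_right a hn), ← sum_filter]
    refine sum_congr ?_ fun _ _ => rfl
    ext d
    simp only [Nat.mem_divisors, mem_filter, Nat.dvd_gcd_iff]
    have : a.gcd n ≠ 0 := (Nat.gcd_pos_of_pos_right a hn).ne'
    have := hn.ne'
    tauto
  have hmul : ∀ d ∈ n.divisors, ∃ k : ℤ,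
      ∑ a ∈ range n, (if d ∣ a then omega n ^ (j * a) else 0) = k := fun d hd => by
    obtain ⟨e, he⟩ := (Nat.mem_divisors.mp hd).1
    have hd0 : 0 < d := Nat.pos_of_mem_divisors hd
    have : ∑ a ∈ range n, (if d ∣ a then omega n ^ (j * a) else 0) =
        ∑ i ∈ range e, (omega n ^ (j * d)) ^ i := by
      rw [← sum_filter]
      symm
      refine sum_nbij (fun i => d * i) ?_ ?_ ?_ ?_
      · intro i hi
        simp only [mem_filter, mem_range, dvd_mul_right, and_true] at hi ⊢
        rw [he]
        exact Nat.mul_lt_mul_of_pos_left hi hd0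
      · exact fun x _ y _ h => Nat.eq_of_mul_eq_mul_left hd0 h
      · intro a ha
        simp only [coe_filter, mem_range, Set.mem_ofPred_eq] at ha
        obtain ⟨hlt, i, rfl⟩ := ha
        refine ⟨i, ?_, rfl⟩
        rw [he] at hlt
        simpa using Nat.lt_of_mul_lt_mul_left hlt
      · intro i _
        rw [← pow_mul, mul_assoc]
    rw [this]
    by_cases h1 : omega n ^ (j * d) = 1
    · exact ⟨e, by simp [h1]⟩
    · refine ⟨0, ?_⟩
      rw [geom_sum_eq_zero_of_pow_eq_one ?_ h1, Int.cast_zero]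
      rw [← pow_mul, mul_assoc, ← he, mul_comm, pow_mul, omega_pow_self, one_pow]
  choose! k hk using hmul
  refine ⟨∑ d ∈ n.divisors, c d * k d, ?_⟩
  rw [eigenvalue_eq_sum_range hD]
  simp only [hind]
  push_cast
  simp only [sum_mul]
  rw [sum_comm]
  refine sum_congr rfl fun d hd => ?_
  rw [← hk d hd, mul_sum]
  refine sum_congr rfl fun a _ => ?_
  split_ifs <;> simp

end ICG

namespace ICG

theorem omega_pow_half {n x : ℕ} [NeZero n] (hx : n = 2 * x) : omega n ^ x = -1 := by
  have hn : n ≠ 0 := NeZero.ne n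
  have hsq : (omega n ^ x) ^ 2 = 1 := by
    rw [← pow_mul, mul_comm, ← hx, omega_pow_self]
  exact ((mul_self_eq_one_iff (a := omega n ^ x)).mp (by rwa [← sq])).resolve_left
    ((isPrimitiveRoot_omega n).pow_ne_one_of_pos_of_lt (by omega) (by omega))

/-- Perfect state transfer determines the spectral phases. -/
theorem exists_int_phase_of_hasPST {n : ℕ} [NeZero n] {D : Finset ℕ} {L : ℕ → ℤ}
    (hL : ∀ j, eigenvalue n D j = L j) (h : (graph n D).HasPST) :
    Even n ∧ ∃ t : ℝ, t ≠ 0 ∧ ∀ j, ∃ q : ℤ, t * (L j - L 0) = Real.pi * (2 * q - j) := by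
  obtain ⟨a, b, hab, t, ht, hF⟩ := h
  rw [transition_apply] at hF
  set x := (a - b).val with hx
  have hx0 : x ≠ 0 := fun h0 => hab (sub_eq_zero.mp ((ZMod.val_eq_zero _).mp h0))
  have hxn : x < n := ZMod.val_lt _
  set z : ℕ → ℂ := fun j => Complex.exp (Complex.I * t * eigenvalue n D j) * omega n ^ (j * x)
    with hz
  have hnorm : ∀ j, ‖z j‖ = 1 := fun j => by
    have : Complex.I * t * eigenvalue n D j = ((t * L j : ℝ) : ℂ) * Complex.I := by
      rw [hL]; push_cast; ring
    simp only [hz]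
    rw [norm_mul, norm_pow, norm_omega, one_pow, this, Complex.norm_exp_ofReal_mul_I, one_mul]
  have heq : ∀ j < n, z j = z 0 := fun j hj =>
    (Complex.eq_average_of_norm_average_eq_one hnorm hF hj).trans
      (Complex.eq_average_of_norm_average_eq_one hnorm hF (by omega)).symm
  have hn2 : n = 2 * x := by
    have h1 : omega n ^ (1 * x) = omega n ^ ((n - 1) * x) := by
      have := (heq 1 (by omega)).trans (heq (n - 1) (by omega)).symm
      simp only [hz] at this
      rw [eigenvalue_sub n D (by omega : 1 ≤ n)] at this
      exact mul_left_cancel₀ (Complex.exp_ne_zero _) this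
    have h2 : omega n ^ (2 * x) = 1 := by
      rw [two_mul, pow_add]
      nth_rw 2 [← one_mul x]
      rw [h1, ← pow_add]
      have : x + (n - 1) * x = n * x := by
        obtain ⟨n', rfl⟩ : ∃ n', n = n' + 1 := ⟨n - 1, by omega⟩
        simp only [Nat.add_sub_cancel]; ring
      rw [this, pow_mul, omega_pow_self, one_pow]
    obtain ⟨c, hc⟩ := ((isPrimitiveRoot_omega n).pow_eq_one_iff_dvd _).mp h2
    have : c < 2 := by
      by_contra hge
      have : n * 2 ≤ n * c := Nat.mul_le_mul_left n (by omega)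
      omega
    interval_cases c <;> omega
  refine ⟨⟨x, by omega⟩, t, ht.ne', fun j => ?_⟩
  have hpow : ∀ j, omega n ^ (j * x) = (-1) ^ j := fun j => by
    rw [mul_comm, pow_mul, omega_pow_half hn2]
  have hzj : z j = z 0 := by
    have : z j = z (j % n) := by
      simp only [hz]
      rw [eigenvalue_mod, mul_comm (j % n), omega_pow_mul_mod, mul_comm j]
    rw [this, heq _ (Nat.mod_lt _ (by omega))]
  simp only [hz, hpow, hL, pow_zero, mul_one] at hzj
  have hneg : ((-1 : ℂ)) ^ j = Complex.exp (j * (Real.pi * Complex.I)) := by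
    rw [Complex.exp_nat_mul, Complex.exp_pi_mul_I]
  rw [hneg, ← Complex.exp_add] at hzj
  obtain ⟨q, hq⟩ := Complex.exp_eq_exp_iff_exists_int.mp hzj
  refine ⟨q, ?_⟩
  have hI : Complex.I * ((t * (L j - L 0) - Real.pi * (2 * q - j) : ℝ) : ℂ) = 0 := by
    push_cast
    linear_combination hq
  have := (mul_eq_zero.mp hI).resolve_left Complex.I_ne_zero
  exact sub_eq_zero.mp (by exact_mod_cast this)

theorem exists_modEq_two_pow {L : ℕ → ℤ} {t : ℝ} (ht : t ≠ 0)
    (h : ∀ j : ℕ, ∃ q : ℤ, t * (L j - L 0) = Real.pi * (2 * q - j)) :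
    ∃ M : ℕ, ∀ j : ℕ, L j ≡ L 0 + 2 ^ M * j [ZMOD 2 ^ (M + 1)] := by
  choose q hq using h
  have hcross : ∀ j : ℕ, (L j - L 0) * (2 * q 1 - 1) = (L 1 - L 0) * (2 * q j - j) := fun j => by
    have : t * Real.pi * ((L j - L 0) * (2 * q 1 - 1)) =
        t * Real.pi * ((L 1 - L 0) * (2 * q j - j)) := by
      have h1 := hq 1
      push_cast at h1
      linear_combination Real.pi * (2 * q 1 - 1) * hq j - Real.pi * (2 * q j - j) * h1
    exact_mod_cast mul_left_cancel₀ (mul_ne_zero ht Real.pi_ne_zero) this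
  have hne : L 1 - L 0 ≠ 0 := fun h0 => by
    have h1 := hq 1
    have h0' : (L 1 : ℝ) - L 0 = 0 := by exact_mod_cast h0
    rw [h0', mul_zero, eq_comm, mul_eq_zero, or_iff_right Real.pi_ne_zero] at h1
    have : 2 * q 1 - 1 = 0 := by exact_mod_cast h1
    omega
  obtain ⟨o, ho, hMo⟩ := (Int.finiteMultiplicity_iff (a := 2).mpr
    ⟨by norm_num, hne⟩).exists_eq_pow_mul_and_not_dvd
  set M := multiplicity 2 (L 1 - L 0)
  refine ⟨M, fun j => ?_⟩
  have hodd : IsCoprime ((2 : ℤ) ^ M) (2 * q 1 - 1) := by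
    refine IsCoprime.pow_left ⟨q 1, -1, by ring⟩
  obtain ⟨u, hu⟩ : (2 : ℤ) ^ M ∣ L j - L 0 :=
    hodd.dvd_of_dvd_mul_right ⟨o * (2 * q j - j), by rw [hcross, ho]; ring⟩
  have huw : u * (2 * q 1 - 1) = o * (2 * q j - j) := by
    have h2 : (2 : ℤ) ^ M ≠ 0 := by positivity
    refine mul_left_cancel₀ h2 ?_
    rw [← mul_assoc, ← hu, hcross, ho]; ring
  have hpar : (2 : ℤ) ∣ j - u := by
    have ho2 : Odd o := by rwa [← Int.not_even_iff_odd, even_iff_two_dvd]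
    obtain ⟨c, rfl⟩ := ho2
    refine ⟨(2 * c + 1) * q j - c * j - u * q 1 , ?_⟩
    linear_combination huw
  refine Int.modEq_iff_dvd.mpr ?_
  rw [show L 0 + 2 ^ M * (j : ℤ) - L j = 2 ^ M * (j - u) by linear_combination -hu, pow_succ]
  exact mul_dvd_mul_left _ hpar

theorem indicator_add {k m y r : ℕ} (D : Finset ℕ) (hm : Nat.Coprime (2 ^ k) m) :
    indicator (2 ^ k * m) D (2 ^ k * y + m * r) =
      if y.gcd m * r.gcd (2 ^ k) ∈ D then 1 else 0 := by
  have h1 : (2 ^ k * y + m * r).gcd (2 ^ k) = r.gcd (2 ^ k) := by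
    rw [add_comm, Nat.gcd_add_mul_left_left, Nat.Coprime.gcd_mul_left_cancel _ hm.symm]
  have h2 : (2 ^ k * y + m * r).gcd m = y.gcd m := by
    rw [Nat.gcd_add_mul_left_left, Nat.Coprime.gcd_mul_left_cancel _ hm]
  rw [indicator, Nat.Coprime.gcd_mul _ hm, h1, h2, mul_comm]

open Finset in
theorem eigenvalue_eq_sum_sum {n k m : ℕ} [NeZero n] {D : Finset ℕ} (hD : n ∉ D)
    (hn : n = 2 ^ k * m) (hm : Nat.Coprime (2 ^ k) m) (b c i : ℕ) :
    eigenvalue n D (m * c + b * i) = ∑ y ∈ range m,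
      (∑ r ∈ range (2 ^ k), (if y.gcd m * r.gcd (2 ^ k) ∈ D then 1 else 0) *
        (omega n ^ (m * (m * c + b * i))) ^ r) * (omega n ^ (2 ^ k * b)) ^ (i * y) := by
  have hm0 : 0 < m := Nat.pos_of_ne_zero fun h => NeZero.ne n (by rw [hn, h, mul_zero])
  have h1 : omega n ^ (2 ^ k * m) = 1 := hn ▸ omega_pow_self n
  rw [eigenvalue_eq_sum_range hD, show range n = range (2 ^ k * m) by rw [hn],
    hm.sum_range_mul (by positivity) hm0 (F := fun a => (indicator n D a : ℂ) *
      omega n ^ ((m * c + b * i) * a)) fun a => by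
        rw [← hn, indicator_mod, omega_pow_mul_mod]]
  refine sum_congr rfl fun y _ => ?_
  rw [sum_mul]
  refine sum_congr rfl fun r _ => ?_
  have hind : indicator n D (2 ^ k * y + m * r) =
      if y.gcd m * r.gcd (2 ^ k) ∈ D then 1 else 0 := by
    rw [← indicator_add D hm, ← hn]
  have hexp : omega n ^ ((m * c + b * i) * (2 ^ k * y + m * r)) =
      (omega n ^ (2 ^ k * m)) ^ (c * y) * ((omega n ^ (m * (m * c + b * i))) ^ r *
        (omega n ^ (2 ^ k * b)) ^ (i * y)) := by
    simp only [← pow_mul, ← pow_add]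
    congr 1
    ring
  rw [hind, hexp, h1, one_pow, one_mul, mul_assoc]
  push_cast
  rfl

/-- If the eigenvalues with index `m c + b i` are all congruent to `e` modulo a power of two, then
so is the corresponding local Fourier coefficient at `0`, and those at other places vanish modulo
that power. -/
theorem dvd_of_eigenvalue_modEq {n k m b c N : ℕ} [NeZero n] {D : Finset ℕ} (hD : n ∉ D)
    (hn : n = 2 ^ (k + 1) * m) (hm : Odd m) (hb : b.Coprime m) {L : ℕ → ℤ}
    (hL : ∀ j, eigenvalue n D j = L j) {e : ℤ}
    (hLe : ∀ i : ℕ, L (m * c + b * i) ≡ e [ZMOD 2 ^ N]) {h : ℕ → ℤ}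
    (hh : ∀ i y : ℕ, ∑ r ∈ Finset.range (2 ^ (k + 1)),
      (if y.gcd m * r.gcd (2 ^ (k + 1)) ∈ D then 1 else 0) *
        (omega n ^ (m * (m * c + b * i))) ^ r = (h y : ℂ)) {y : ℕ} (hy : y < m) :
    (2 : ℤ) ^ N ∣ h y - if y = 0 then e else 0 := by
  have h2m : Nat.Coprime 2 m := Nat.coprime_two_left.mpr hm
  have hθ : IsPrimitiveRoot (omega n ^ (2 ^ (k + 1) * b)) m := by
    rw [pow_mul]
    exact ((isPrimitiveRoot_omega n).pow (NeZero.pos n) hn).pow_of_coprime _ hb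
  refine hθ.dvd_of_sum_modEq (by positivity) ?_ (fun i => ⟨_, hLe i, ?_⟩) hy
  · exact_mod_cast (Nat.isCoprime_iff_coprime.mpr h2m).pow_left (m := N)
  · rw [← hL, eigenvalue_eq_sum_sum hD hn (h2m.pow_left _)]
    simp only [hh]

theorem omega_pow_mul_pow_of_odd {n k m J : ℕ} [NeZero n] (hn : n = 2 ^ (k + 1) * m)
    (hJ : Odd J) : (omega n ^ (m * J)) ^ 2 ^ k = -1 := by
  rw [← pow_mul, show m * J * 2 ^ k = m * 2 ^ k * J by ring, pow_mul,
    omega_pow_half (by rw [hn]; ring), hJ.neg_one_pow]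

theorem modEq_of_even {L : ℕ → ℤ} {M J : ℕ}
    (hM : ∀ j : ℕ, L j ≡ L 0 + 2 ^ M * j [ZMOD 2 ^ (M + 1)]) (hJ : Even J) :
    L J ≡ L 0 [ZMOD 2 ^ (M + 1)] := by
  obtain ⟨c, rfl⟩ := hJ
  refine (hM _).trans (Int.modEq_iff_dvd.mpr ⟨-c, ?_⟩)
  push_cast
  ring

theorem modEq_of_odd {L : ℕ → ℤ} {M J : ℕ}
    (hM : ∀ j : ℕ, L j ≡ L 0 + 2 ^ M * j [ZMOD 2 ^ (M + 1)]) (hJ : Odd J) :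
    L J ≡ L 0 + 2 ^ M [ZMOD 2 ^ (M + 1)] := by
  obtain ⟨c, rfl⟩ := hJ
  refine (hM _).trans (Int.modEq_iff_dvd.mpr ⟨-c, ?_⟩)
  push_cast
  ring

open Finset in
/-- If `L j ≡ L 0 + 2 ^ M j` modulo `2 ^ (M + 1)` for the eigenvalues, then the eigenvalues of
odd index are all equal to `-[n / 2 ∈ D]`. -/
theorem eigenvalue_odd {n k m M : ℕ} [NeZero n] {D : Finset ℕ} (hD : n ∉ D)
    (hn : n = 2 ^ (k + 1) * m) (hm : Odd m) {L : ℕ → ℤ} (hL : ∀ j, eigenvalue n D j = L j)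
    (hM : ∀ j : ℕ, L j ≡ L 0 + 2 ^ M * j [ZMOD 2 ^ (M + 1)]) {j : ℕ} (hj : Odd j) :
    L j = -(if m * 2 ^ k ∈ D then 1 else 0) := by
  have hm0 : 0 < m := hm.pos
  have h2m : Nat.Coprime 2 m := Nat.coprime_two_left.mpr hm
  let h : ℕ → ℤ := fun y => (if y.gcd m * 2 ^ (k + 1) ∈ D then 1 else 0) -
    (if y.gcd m * 2 ^ k ∈ D then 1 else 0)
  have hsum : ∀ J y : ℕ, Odd J → ∑ r ∈ range (2 ^ (k + 1)),
      (if y.gcd m * r.gcd (2 ^ (k + 1)) ∈ D then 1 else 0) * (omega n ^ (m * J)) ^ r =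
        (h y : ℂ) := fun J y hJ => by
    rw [sum_gcd_two_pow_mul_pow_of_half (omega_pow_mul_pow_of_odd hn hJ)
      fun g => if y.gcd m * g ∈ D then 1 else 0]
    simp [h]
  have hodd : ∀ i : ℕ, Odd (m * 1 + 2 * i) := fun i => by
    rw [mul_one]; exact hm.add_even (even_two_mul i)
  have hdvd : ∀ y < m, y ≠ 0 → h y = 0 := fun y hy hy0 => by
    have h1 := dvd_of_eigenvalue_modEq (c := 1) hD hn hm h2m hL
      (fun i => modEq_of_odd hM (hodd i)) (fun i y => hsum _ y (hodd i)) hy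
    rw [if_neg hy0, sub_zero] at h1
    have h2 : (2 : ℤ) ∣ h y := (dvd_pow_self 2 M.succ_ne_zero).trans h1
    simp only [h] at h2 ⊢
    split_ifs at h2 ⊢ <;> omega
  have hLj := eigenvalue_eq_sum_sum hD hn (h2m.pow_left _) 1 0 j
  rw [mul_zero, one_mul, zero_add, hL] at hLj
  simp only [hsum j _ hj] at hLj
  rw [sum_eq_single_of_mem 0 (by simpa using hm0)
    fun y hy hy0 => by rw [hdvd y (mem_range.mp hy) hy0]; simp] at hLj
  rw [mul_zero, pow_zero, mul_one, Int.cast_inj] at hLj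
  rw [hLj]
  have : m * 2 ^ (k + 1) ∉ D := by rwa [mul_comm, ← hn]
  simp [h, this]

theorem eq_one_of_two_pow_dvd {M : ℕ} {x : ℤ} (hx : |x| ≤ 1)
    (h : (2 : ℤ) ^ (M + 1) ∣ 2 * x + 2 ^ M) : M = 1 := by
  rw [abs_le] at hx
  match M with
  | 0 => norm_num at h
  | 1 => rfl
  | M + 2 =>
    exfalso
    have h4 : (4 : ℤ) ∣ 2 ^ (M + 2) := ⟨2 ^ M, by ring⟩
    have h4' : (4 : ℤ) ∣ 2 ^ (M + 2 + 1) := ⟨2 ^ M * 2, by ring⟩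
    have hx0 : x = 0 := by
      have := h4'.trans h
      omega
    rw [hx0, mul_zero, zero_add, pow_dvd_pow_iff two_ne_zero Int.prime_two.not_isUnit] at h
    omega

theorem exponent_eq_one {n k m M : ℕ} [NeZero n] {D : Finset ℕ} (hD : n ∉ D)
    (hn : n = 2 ^ (k + 1) * m) (hm : Odd m) {L : ℕ → ℤ} (hL : ∀ j, eigenvalue n D j = L j)
    (hM : ∀ j : ℕ, L j ≡ L 0 + 2 ^ M * j [ZMOD 2 ^ (M + 1)]) : M = 1 := by
  have hm0 : 0 < m := hm.pos
  have hb : Nat.Coprime 4 m := (Nat.coprime_two_left.mpr hm).pow_left 2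
  have hnD : m * 2 ^ (k + 1) ∉ D := by rwa [mul_comm, ← hn]
  have heven : ∀ i : ℕ, Even (m * 2 + 4 * i) := fun i => ⟨m + 2 * i, by ring⟩
  have hL1 : L 0 + 2 ^ M ≡ -(if m * 2 ^ k ∈ D then 1 else 0) [ZMOD 2 ^ (M + 1)] := by
    rw [← eigenvalue_odd hD hn hm hL hM odd_one]
    exact (modEq_of_odd hM odd_one).symm
  have key : ∀ h : ℕ → ℤ, (∀ i y : ℕ, ∑ r ∈ Finset.range (2 ^ (k + 1)),
      (if y.gcd m * r.gcd (2 ^ (k + 1)) ∈ D then 1 else 0) *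
        (omega n ^ (m * (m * 2 + 4 * i))) ^ r = (h y : ℂ)) →
      (2 : ℤ) ^ (M + 1) ∣ h 0 + (if m * 2 ^ k ∈ D then 1 else 0) + 2 ^ M := fun h hh => by
    have h1 := dvd_of_eigenvalue_modEq hD hn hm hb hL (fun i => modEq_of_even hM (heven i)) hh hm0
    rw [if_pos rfl] at h1
    have := dvd_sub h1 hL1.dvd
    rwa [show h 0 + (if m * 2 ^ k ∈ D then 1 else 0) + 2 ^ M = h 0 - L 0 -
      (-(if m * 2 ^ k ∈ D then 1 else 0) - (L 0 + 2 ^ M)) by ring]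
  match k with
  | 0 =>
    have h1 := key (fun y => (if y.gcd m ∈ D then 1 else 0) +
        if y.gcd m * 2 ∈ D then 1 else 0) fun i y => by
      have hz : omega n ^ (m * (m * 2 + 4 * i)) = 1 := by
        rw [show m * (m * 2 + 4 * i) = n * (m + 2 * i) by rw [hn]; ring, pow_mul, omega_pow_self,
          one_pow]
      rw [hz]
      rw [zero_add, pow_one, Finset.sum_range_succ, Finset.sum_range_one]
      simp [add_comm]
    norm_num at h1 hnD
    refine eq_one_of_two_pow_dvd (x := if m ∈ D then 1 else 0) (by split_ifs <;> simp) ?_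
    simpa only [Nat.gcd_zero_left, if_neg hnD, add_zero, two_mul] using h1
  | k + 1 =>
    have h1 := key (fun y => (if y.gcd m * 2 ^ (k + 2) ∈ D then 1 else 0) +
        (if y.gcd m * 2 ^ (k + 1) ∈ D then 1 else 0) -
          2 * if y.gcd m * 2 ^ k ∈ D then 1 else 0) fun i y => by
      have hz : (omega n ^ (m * (m * 2 + 4 * i))) ^ 2 ^ k = -1 := by
        rw [← omega_pow_mul_pow_of_odd hn (J := m + 2 * i) (hm.add_even (even_two_mul i)),
          ← pow_mul, ← pow_mul]
        congr 1
        ring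
      rw [sum_gcd_two_pow_mul_pow_of_quarter hz fun g => if y.gcd m * g ∈ D then 1 else 0]
      push_cast
      rfl
    refine eq_one_of_two_pow_dvd (x := (if m * 2 ^ (k + 1) ∈ D then 1 else 0) -
      if m * 2 ^ k ∈ D then 1 else 0) (by split_ifs <;> simp) ?_
    simp only [Nat.gcd_zero_left, if_neg hnD] at h1
    convert h1 using 1
    ring

open Finset in
/-- If the eigenvalues are `L 0 + 2 j` modulo `4`, then there is perfect state transfer between
opposite vertices at time `π / 2`. -/
theorem hasPST_of_modEq_four {n : ℕ} [NeZero n] {D : Finset ℕ} (hn : Even n) {e : ℤ}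
    (h : ∀ j < n, ∃ l : ℤ, eigenvalue n D j = l ∧ l ≡ e + 2 * j [ZMOD 4]) :
    (graph n D).HasPST := by
  obtain ⟨x, hx⟩ := hn
  have hn0 : n ≠ 0 := NeZero.ne n
  have hval : (x : ZMod n).val = x := ZMod.val_cast_of_lt (by omega)
  refine ⟨x, 0, fun h0 => ?_, Real.pi / 2, by positivity, ?_⟩
  · rw [h0, ZMod.val_zero] at hval
    omega
  · rw [transition_apply, sub_zero, hval]
    have hterm : ∀ j ∈ range n, Complex.exp (Complex.I * (Real.pi / 2 : ℝ) * eigenvalue n D j) *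
        omega n ^ (j * x) = Complex.exp ((Real.pi / 2 * e : ℝ) * Complex.I) := fun j hj => by
      obtain ⟨l, hl, hle⟩ := h j (mem_range.mp hj)
      obtain ⟨q, hq⟩ := hle.dvd
      have hpow : omega n ^ (j * x) = Complex.exp (j * (Real.pi * Complex.I)) := by
        rw [mul_comm, pow_mul, omega_pow_half (by omega), Complex.exp_nat_mul,
          Complex.exp_pi_mul_I]
      rw [hl, hpow, ← Complex.exp_add, Complex.exp_eq_exp_iff_exists_int]
      refine ⟨j - q, ?_⟩
      have hq' : (e : ℂ) + 2 * j - l = 4 * q := by exact_mod_cast hq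
      push_cast
      linear_combination -(Real.pi / 2 * Complex.I) * hq'
    rw [sum_congr rfl hterm, sum_const, card_range, nsmul_eq_mul,
      inv_mul_cancel_left₀ (by exact_mod_cast hn0), Complex.norm_exp_ofReal_mul_I]

end ICG

theorem mainTheorem4 (n : ℕ) [NeZero n] (D : Finset ℕ) (hD : D ⊆ n.properDivisors) :
    (ICG.graph n D).HasPST ↔
      ((¬ ∃ d ∈ D, 2 * d = n) ∧ ∀ j < n,
        (Even j → ∃ k : ℤ, k ≡ 2 [ZMOD 4] ∧ ICG.eigenvalue n D j = k) ∧
        (Odd j → ICG.eigenvalue n D j = 0)) ∨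
      ((∃ d ∈ D, 2 * d = n) ∧ ∀ j < n,
        (Even j → ∃ k : ℤ, k ≡ 1 [ZMOD 4] ∧ ICG.eigenvalue n D j = k) ∧
        (Odd j → ICG.eigenvalue n D j = -1)) := by
  have hnD : n ∉ D := fun h => (Nat.mem_properDivisors.mp (hD h)).2.ne rfl
  have hn0 : n ≠ 0 := NeZero.ne n
  constructor
  · intro hPST
    choose L hL using ICG.exists_int_eigenvalue hnD
    obtain ⟨hn, t, ht, hphase⟩ := ICG.exists_int_phase_of_hasPST hL hPST
    obtain ⟨M, hM⟩ := ICG.exists_modEq_two_pow ht hphase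
    obtain ⟨k, m, hm, hkm⟩ := Nat.exists_eq_two_pow_mul_odd hn0
    obtain ⟨k, rfl⟩ : ∃ k', k = k' + 1 := by
      refine Nat.exists_eq_succ_of_ne_zero fun h0 => ?_
      rw [h0, pow_zero, one_mul] at hkm
      exact Nat.not_even_iff_odd.mpr (hkm ▸ hm) hn
    obtain rfl := ICG.exponent_eq_one hnD hkm hm hL hM
    have hhalf : (∃ d ∈ D, 2 * d = n) ↔ m * 2 ^ k ∈ D := by
      have : 2 * (m * 2 ^ k) = n := by rw [hkm]; ring
      exact ⟨fun ⟨d, hd, h⟩ => (by omega : d = m * 2 ^ k) ▸ hd, fun h => ⟨_, h, this⟩⟩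
    have hodd : ∀ j, Odd j → L j = _ := fun j hj => ICG.eigenvalue_odd hnD hkm hm hL hM hj
    have h1 := hodd 1 odd_one
    have hL1 := ICG.modEq_of_odd hM odd_one
    rw [hhalf]
    by_cases hmD : m * 2 ^ k ∈ D
    · simp only [if_pos hmD] at hodd h1
      refine Or.inr ⟨hmD, fun j _ => ⟨fun hj => ⟨L j, ?_, hL j⟩, fun hj => ?_⟩⟩
      · have := ICG.modEq_of_even hM hj
        rw [h1] at hL1
        simp only [Int.ModEq] at *
        omega
      · rw [hL, hodd j hj]
        simp
    · simp only [if_neg hmD] at hodd h1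
      refine Or.inl ⟨hmD, fun j _ => ⟨fun hj => ⟨L j, ?_, hL j⟩, fun hj => ?_⟩⟩
      · have := ICG.modEq_of_even hM hj
        rw [h1] at hL1
        simp only [Int.ModEq] at *
        omega
      · rw [hL, hodd j hj]
        simp
  · rintro (⟨-, h⟩ | ⟨⟨d, -, hd⟩, h⟩)
    · have hn : Even n := by
        by_contra hodd
        rw [Nat.not_even_iff_odd] at hodd
        obtain ⟨c, hc⟩ := hodd
        rcases Nat.eq_zero_or_pos c with rfl | hc0
        · obtain rfl : n = 1 := hc
          obtain ⟨l, hl, hl0⟩ := (h 0 one_pos).1 ⟨0, rfl⟩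
          obtain rfl : D = ∅ := by simpa using hD
          simp only [ICG.eigenvalue, ICG.symbol, Finset.biUnion_empty, Finset.sum_empty] at hl0
          have : l = 0 := by exact_mod_cast hl0.symm
          rw [this] at hl
          exact absurd hl (by decide)
        · obtain ⟨l, hl, hl0⟩ := (h (n - 1) (by omega)).1 ⟨c, by omega⟩
          rw [ICG.eigenvalue_sub n D (by omega), (h 1 (by omega)).2 odd_one] at hl0
          have : l = 0 := by exact_mod_cast hl0.symm
          rw [this] at hl
          exact absurd hl (by decide)
      refine ICG.hasPST_of_modEq_four hn (e := 2) fun j hj => ?_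
      rcases Nat.even_or_odd j with hj2 | hj2
      · obtain ⟨l, hl, hl0⟩ := (h j hj).1 hj2
        obtain ⟨c, rfl⟩ := hj2
        refine ⟨l, hl0, ?_⟩
        simp only [Int.ModEq] at *
        push_cast
        omega
      · refine ⟨0, by simpa using (h j hj).2 hj2, ?_⟩
        obtain ⟨c, rfl⟩ := hj2
        simp only [Int.ModEq]
        push_cast
        omega
    · refine ICG.hasPST_of_modEq_four ⟨d, by omega⟩ (e := 1) fun j hj => ?_
      rcases Nat.even_or_odd j with hj2 | hj2
      · obtain ⟨l, hl, hl0⟩ := (h j hj).1 hj2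
        obtain ⟨c, rfl⟩ := hj2
        refine ⟨l, hl0, ?_⟩
        simp only [Int.ModEq] at *
        push_cast
        omega
      · refine ⟨-1, by simpa using (h j hj).2 hj2, ?_⟩
        obtain ⟨c, rfl⟩ := hj2
        simp only [Int.ModEq]
        push_cast
        omega
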